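/- Let $K$ be an algebraically closed field of characteristic $0$, let $\mathbb{A}^n = K^n$ carry the Zariski topology, and for an algebraic subset $W\subseteq\mathbb{A}^m$ let $I(W)$ denote the ideal of all polynomials vanishing on $W$; $W$ is called smooth if the local ring of $W$ at each of its points is a regular local ring. Let $V\subseteq\mathbb{A}^n$ be a smooth irreducible algebraic variety of dimension $d$, for $p\in V$ let $$T_pV=\{y\in K^n \mid \nabla f(p)\cdot y=0 \text{ for all } f\in I(V)\},$$ where $\nabla f(p)\cdot y=\sum_{i=1}^n \frac{\partial f}{\partial x_i}(p)\,y_i$, and let $$TV=\{(x,y)\in\mathbb{A}^{2n}\mid x\in V,\ y\in T_xV\}$$ be the tangent bundle of $V$. Then $TV\subseteq\mathbb{A}^{2n}$ is an algebraic variety that is smooth and irreducible, and $\dim(TV)=2d$. Moreover, if $I(V)=(f_1,\dots,f_r)\subseteq K[x_1,\dots,x_n]$, then $$I(TV)=(f_1,\dots,f_r,\nabla f_1\cdot \mathbf{y},\dots,\nabla f_r\cdot\mathbf{y})\subseteq K[x_1,\dots,x_n,y_1,\dots,y_n],$$ where $y_1,\dots,y_n$ are new indeterminates and $\nabla f_j\cdot\mathbf{y}=\sum_{i=1}^n\frac{\partial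 f_j}{\partial x_i}\,y_i$. -/

import Mathlib

noncomputable section

namespace AffineVariety

open MvPolynomial

/-- A subset of affine space `K^σ` is algebraic (Zariski closed) if it is the set of common zeros
of the polynomials in some ideal. -/
def IsAlgebraicSet {K σ : Type*} [Field K] (V : Set (σ → K)) : Prop :=
  ∃ I : Ideal (MvPolynomial σ K), V = zeroLocus K I

theorem isAlgebraicSet_empty {K σ : Type*} [Field K] : IsAlgebraicSet (∅ : Set (σ → K)) :=
  ⟨⊤, by simp⟩

theorem isAlgebraicSet_sInter {K σ : Type*} [Field K] (A : Set (Set (σ → K)))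
    (hA : ∀ V ∈ A, IsAlgebraicSet V) : IsAlgebraicSet (⋂₀ A) := by
  refine ⟨vanishingIdeal K (⋂₀ A), Set.Subset.antisymm (zeroLocus_vanishingIdeal_le _) ?_⟩
  intro x hx V hV
  obtain ⟨I, rfl⟩ := hA V hV
  intro p hp
  exact hx p fun z hz => hz _ hV p hp

theorem isAlgebraicSet_union {K σ : Type*} [Field K] (V W : Set (σ → K))
    (hV : IsAlgebraicSet V) (hW : IsAlgebraicSet W) : IsAlgebraicSet (V ∪ W) := by
  obtain ⟨I, rfl⟩ := hV
  obtain ⟨J, rfl⟩ := hW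
  refine ⟨I * J, Set.Subset.antisymm ?_ ?_⟩
  · rintro x (hx | hx)
    · exact zeroLocus_anti_mono Ideal.mul_le_left hx
    · exact zeroLocus_anti_mono Ideal.mul_le_right hx
  · intro x hx
    by_contra hcon
    simp only [Set.mem_union, mem_zeroLocus_iff, not_or, not_forall] at hcon
    obtain ⟨⟨p, hp, hp0⟩, q, hq, hq0⟩ := hcon
    have h := hx (p * q) (Ideal.mul_mem_mul hp hq)
    rw [map_mul] at h
    exact (mul_ne_zero hp0 hq0) h

/-- The Zariski topology on the affine space `K^σ`: the closed sets are the algebraic sets. -/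
@[reducible]
def zariskiTopology (K σ : Type*) [Field K] : TopologicalSpace (σ → K) :=
  TopologicalSpace.ofClosed {V | IsAlgebraicSet V} isAlgebraicSet_empty
    (fun A hA => isAlgebraicSet_sInter A fun _ hV => hA hV)
    (fun V hV W hW => isAlgebraicSet_union V W hV hW)

/-- `V` is irreducible (in particular nonempty) for the Zariski topology. -/
def IsIrreducibleSet {K σ : Type*} [Field K] (V : Set (σ → K)) : Prop :=
  @IsIrreducible (σ → K) (zariskiTopology K σ) V

/-- The dimension of `V`: the Krull dimension of the topological space `V` with the topology
induced by the Zariski topology. It is `⊥` for the empty set. -/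
def dimension {K σ : Type*} [Field K] (V : Set (σ → K)) : WithBot ℕ∞ :=
  @topologicalKrullDim V (TopologicalSpace.induced Subtype.val (zariskiTopology K σ))

/-- The coordinate ring `K[V] = K[x] / I(V)`. -/
abbrev CoordinateRing {K σ : Type*} [Field K] (V : Set (σ → K)) : Type _ :=
  MvPolynomial σ K ⧸ vanishingIdeal K V

/-- Evaluation of regular functions on `V` at a point `p` of `V`. -/
def evalAt {K σ : Type*} [Field K] (V : Set (σ → K)) (p : V) : CoordinateRing V →ₐ[K] K :=
  Ideal.Quotient.liftₐ (vanishingIdeal K V) (aeval (p : σ → K)) fun _ hf => hf p p.2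

/-- The ideal of the regular functions on `V` that vanish at the point `p` of `V`. -/
def idealAt {K σ : Type*} [Field K] (V : Set (σ → K)) (p : V) : Ideal (CoordinateRing V) :=
  RingHom.ker (evalAt V p)

instance idealAt_isPrime {K σ : Type*} [Field K] (V : Set (σ → K)) (p : V) :
    (idealAt V p).IsPrime :=
  RingHom.ker_isPrime _

/-- The local ring of `V` at the point `p` of `V`. -/
abbrev LocalRing {K σ : Type*} [Field K] (V : Set (σ → K)) (p : V) : Type _ :=
  Localization.AtPrime (idealAt V p)

/-- `V` is smooth: its local rings at all of its points are regular. -/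
def IsSmooth {K σ : Type*} [Field K] (V : Set (σ → K)) : Prop :=
  ∀ p : V, IsRegularLocalRing (LocalRing V p)

/-- The scalar product `∇f(p) · y` in `K`. -/
def gradDot {K σ : Type*} [Field K] [Fintype σ] (f : MvPolynomial σ K) (p y : σ → K) : K :=
  ∑ i, eval p (pderiv i f) * y i

/-- The tangent space of `V` at `p`, as a linear subspace of `K^σ`:
the vectors `y` with `∇f(p) · y = 0` for all `f ∈ I(V)`. -/
def tangentSpace {K σ : Type*} [Field K] [Fintype σ] (V : Set (σ → K)) (p : σ → K) :
    Submodule K (σ → K) where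
  carrier := {y | ∀ f ∈ vanishingIdeal K V, gradDot f p y = 0}
  zero_mem' f _ := by simp [gradDot]
  add_mem' {y z} hy hz f hf := by
    have h1 := hy f hf
    have h2 := hz f hf
    simp only [gradDot, Pi.add_apply, mul_add, Finset.sum_add_distrib] at h1 h2 ⊢
    rw [h1, h2, add_zero]
  smul_mem' c y hy f hf := by
    have h1 := hy f hf
    simp only [gradDot, Pi.smul_apply, smul_eq_mul, mul_left_comm _ c] at h1 ⊢
    rw [← Finset.mul_sum, h1, mul_zero]

/-- At a point of `V` the tangent space is cut out by any system of generators of `I(V)`. -/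
theorem mem_tangentSpace_iff {K σ ι : Type*} [Field K] [Fintype σ] {V : Set (σ → K)}
    {f : ι → MvPolynomial σ K} (hf : vanishingIdeal K V = Ideal.span (Set.range f))
    {p : σ → K} (hp : p ∈ V) (y : σ → K) :
    y ∈ tangentSpace V p ↔ ∀ j, gradDot (f j) p y = 0 := by
  constructor
  · intro hy j
    exact hy (f j) (hf ▸ Ideal.subset_span ⟨j, rfl⟩)
  · intro h g hg
    have hg' : g ∈ Ideal.span (Set.range f) := hf ▸ hg
    induction hg' using Submodule.span_induction with
    | mem x hx => obtain ⟨j, rfl⟩ := hx; exact h j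
    | zero => simp [gradDot]
    | add a b ha hb iha ihb =>
      have h1 := iha (hf ▸ ha)
      have h2 := ihb (hf ▸ hb)
      simp only [gradDot, map_add, add_mul, Finset.sum_add_distrib] at h1 h2 ⊢
      rw [h1, h2, add_zero]
    | smul a x hx ih =>
      have hx' : x ∈ vanishingIdeal K V := hf ▸ hx
      have h1 := ih hx'
      have h2 : eval p x = 0 := by simpa [aeval_eq_eval] using hx' p hp
      simp only [gradDot, smul_eq_mul, pderiv_mul, map_add, map_mul, h2, mul_zero,
        zero_add, mul_assoc] at h1 ⊢
      rw [← Finset.mul_sum, h1, mul_zero]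

/-- The tangent bundle `TV = {(x, y) | x ∈ V, y ∈ T_x V}`, in the affine space of dimension `2n`
with the `x`-coordinates indexed by `Sum.inl` and the `y`-coordinates indexed by `Sum.inr`. -/
def tangentBundle {K σ : Type*} [Field K] [Fintype σ] (V : Set (σ → K)) : Set (σ ⊕ σ → K) :=
  {z | z ∘ Sum.inl ∈ V ∧ z ∘ Sum.inr ∈ tangentSpace V (z ∘ Sum.inl)}

/-- A polynomial in `K[x]` viewed in `K[x, y]`. -/
def inX {K σ : Type*} [Field K] (f : MvPolynomial σ K) : MvPolynomial (σ ⊕ σ) K :=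
  rename Sum.inl f

/-- The polynomial `∇f · y = ∑ i, (∂f/∂x_i) y_i` in `K[x, y]`. -/
def gradY {K σ : Type*} [Field K] [Fintype σ] (f : MvPolynomial σ K) : MvPolynomial (σ ⊕ σ) K :=
  ∑ i, rename Sum.inl (pderiv i f) * X (Sum.inr i)

end AffineVariety

end

open MvPolynomial

/-! Smoothness enters only through the fact that every tangent space of `V` has dimension `d`: the
embedding dimension of the local ring at `p` equals `dim T_pV`
(`finrank_tangentSpace_le_spanFinrank`, `spanFinrank_le_finrank_tangentSpace`), and all local rings
at points have dimension `d`.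

Constant rank makes the tangent spaces a direct summand of the trivial bundle: there is a matrix `E`
over `K[V]` whose columns are tangent vector fields and whose rows satisfy `e_i ≡ E_i` modulo the
gradients of `I(V)`. Cramer's rule gives this locally (`exists_splitsAlong`), the Nullstellensatz
globally (`exists_splitsAlong_one`).

Now substitute `y ↦ E y`. If `F` vanishes on `TV`, then `F(x, E y)` is zero in `K[V][y]`, while
`F(x, E y) ≡ F(x, y)` modulo the forms `∇g · y` with `g ∈ I(V)`. This gives the generators of
`I(TV)`, and shows it to be the kernel of a map into the domain `K[V][y]`, hence prime.

A tangent space of `TV` has dimension at most `2d`, which bounds `dim TV` from above; `2d`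
algebraically independent regular functions bound it from below. Embedding dimension at most `2d =
dim` is regularity. -/

/-! ### Dimension theory of finitely generated domains over a field. -/

theorem Ideal.IsMaximal.height_mvPolynomial_fin {K : Type*} [Field K] (s : ℕ)
    (M : Ideal (MvPolynomial (Fin s) K)) (hM : M.IsMaximal) : M.height = s := by
  induction s with
  | zero =>
    have h : ringKrullDim (MvPolynomial (Fin 0) K) = 0 := by
      rw [MvPolynomial.ringKrullDim_of_isNoetherianRing, ringKrullDim_eq_zero_of_field]
      simp
    have h1 := Ideal.height_le_ringKrullDim_of_isPrime (I := M)
    rw [h] at h1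
    have h2 : M.height ≤ 0 := by exact_mod_cast h1
    simpa using h2
  | succ s ih =>
    let e := (MvPolynomial.finSuccEquiv K s).toRingEquiv
    let P := M.comap e.symm
    have hP : P.IsMaximal := Ideal.comap_isMaximal_of_equiv e.symm
    -- The Jacobson property keeps the contraction maximal, so the induction hypothesis applies to
    -- it; the last variable adds exactly one to the height.
    have hp : (P.comap Polynomial.C).IsMaximal := Polynomial.isMaximal_comap_C_of_isJacobsonRing P
    have : P.LiesOver (P.comap Polynomial.C) := ⟨rfl⟩
    rw [← RingEquiv.height_comap e.symm M,
      Polynomial.height_eq_height_add_one (P.comap Polynomial.C) P, ih _ hp]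
    push_cast
    rfl

/-- Going down makes the height of `P` the sum of the height of its contraction `p` and the height
of `P` in the fibre `S/pS`. The fibre is integral over the field `R/p`, so all its primes are
maximal and the second term is zero. -/
theorem Ideal.IsMaximal.height_eq_height_under_of_isIntegral {R S : Type*} [CommRing R]
    [CommRing S] [IsNoetherianRing R] [IsNoetherianRing S] [Algebra R S]
    [Algebra.IsIntegral R S] [Algebra.HasGoingDown R S] (P : Ideal S) (hP : P.IsMaximal) :
    P.height = (P.under R).height := by
  have hp : (P.under R).IsMaximal := Ideal.isMaximal_comap_of_isIntegral_of_isMaximal P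
  rw [Ideal.height_eq_height_add_of_liesOver_of_hasGoingDown (P.under R) P]
  have hle : (P.under R).map (algebraMap R S) ≤ P := Ideal.map_comap_le
  have hprime := Ideal.isPrime_map_quotientMk_of_isPrime hle
  have : Ring.KrullDimLE 0 (S ⧸ (P.under R).map (algebraMap R S)) := by
    refine Ring.KrullDimLE.mk₀ fun Q hQ => ?_
    have hQ' : (Q.comap (Ideal.Quotient.mk _)).IsPrime := Ideal.comap_isPrime _ Q
    have h1 : P.under R ≤ (Q.comap (Ideal.Quotient.mk _)).comap (algebraMap R S) := by
      intro x hx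
      rw [Ideal.mem_comap, Ideal.mem_comap, Ideal.Quotient.eq_zero_iff_mem.mpr
        (Ideal.mem_map_of_mem _ hx)]
      exact Q.zero_mem
    have h2 := hp.eq_of_le (Ideal.IsPrime.ne_top (Ideal.comap_isPrime _ _)) h1
    have h3 : (Q.comap (Ideal.Quotient.mk _)).IsMaximal :=
      Ideal.isMaximal_of_isIntegral_of_isMaximal_comap (R := R) _ (h2 ▸ hp)
    have h4 := Ideal.map_eq_top_or_isMaximal_of_surjective
      (Ideal.Quotient.mk ((P.under R).map (algebraMap R S))) Ideal.Quotient.mk_surjective h3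
    rw [Ideal.map_comap_of_surjective _ Ideal.Quotient.mk_surjective] at h4
    exact h4.resolve_left hQ.ne_top
  have hzero := Ideal.height_eq_zero_iff.mpr (Ideal.mem_minimalPrimes_of_krullDimLE_zero
    (P.map (Ideal.Quotient.mk ((P.under R).map (algebraMap R S)))))
  rw [hzero, add_zero]

/-- A finitely generated domain `A` over a field has a dimension `s` which is the height of every
maximal ideal, the Krull dimension and the maximal number of algebraically independent elements. -/
theorem exists_dimension_of_finiteType_isDomain (K A : Type*) [Field K] [CommRing A] [IsDomain A]
    [Algebra K A] [Algebra.FiniteType K A] :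
    ∃ s : ℕ, (∃ g : MvPolynomial (Fin s) K →ₐ[K] A, Function.Injective g) ∧
      (∀ M : Ideal A, M.IsMaximal → M.height = s) ∧ ringKrullDim A = s ∧
      ∀ (ι : Type) [Fintype ι] (x : ι → A), AlgebraicIndependent K x → Fintype.card ι ≤ s := by
  -- Noether normalization. Going down holds for this integral extension because a polynomial ring
  -- over a field is integrally closed.
  obtain ⟨s, g, hg, hint⟩ := exists_integral_inj_algHom_of_fg K A
  have hnoeth : IsNoetherianRing A := Algebra.FiniteType.isNoetherianRing K A
  algebraize [g.toRingHom]
  have : IsScalarTower K (MvPolynomial (Fin s) K) A := IsScalarTower.of_algHom g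
  have hint' : Algebra.IsIntegral (MvPolynomial (Fin s) K) A := ⟨hint⟩
  have hfaith : FaithfulSMul (MvPolynomial (Fin s) K) A :=
    (faithfulSMul_iff_algebraMap_injective _ _).mpr hg
  have hmax : ∀ M : Ideal A, M.IsMaximal → M.height = s := by
    intro M hM
    rw [hM.height_eq_height_under_of_isIntegral (R := MvPolynomial (Fin s) K) M]
    exact Ideal.IsMaximal.height_mvPolynomial_fin s _
      (Ideal.isMaximal_comap_of_isIntegral_of_isMaximal M)
  refine ⟨s, ⟨g, hg⟩, hmax, ?_, ?_⟩
  · apply le_antisymm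
    · rw [ringKrullDim_le_iff_isMaximal_height_le]
      intro M hM
      rw [hmax M hM]
      rfl
    · obtain ⟨M, hM⟩ := Ideal.exists_maximal A
      have := Ideal.height_le_ringKrullDim_of_isPrime (I := M)
      rw [hmax M hM] at this
      exact this
  · intro ι _ x hx
    have h1 := lift_trdeg_add_eq (R := K) (S := MvPolynomial (Fin s) K) (A := A)
    rw [MvPolynomial.trdeg_of_isDomain, trdeg_eq_zero (R := MvPolynomial (Fin s) K)] at h1
    have h2 := hx.lift_cardinalMk_le_trdeg
    simp at h1 h2
    rw [← h1] at h2
    simpa using h2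

/-! ### Zariski closed sets and ideals. -/

namespace AffineVariety

theorem isClosed_zariskiTopology_iff {K σ : Type*} [Field K] {Z : Set (σ → K)} :
    @IsClosed _ (zariskiTopology K σ) Z ↔ IsAlgebraicSet Z := by
  rw [← @isOpen_compl_iff _ _ (zariskiTopology K σ)]
  change Zᶜᶜ ∈ {V | IsAlgebraicSet V} ↔ _
  rw [compl_compl]
  rfl

theorem IsAlgebraicSet.zeroLocus_vanishingIdeal {K σ : Type*} [Field K] {V : Set (σ → K)}
    (hV : IsAlgebraicSet V) : zeroLocus K (vanishingIdeal K V) = V := by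
  obtain ⟨I, rfl⟩ := hV
  exact Set.Subset.antisymm (zeroLocus_anti_mono (le_vanishingIdeal_zeroLocus I))
    (zeroLocus_vanishingIdeal_le _)

theorem isIrreducibleSet_iff_isPrime_vanishingIdeal {K σ : Type*} [Field K] {Z : Set (σ → K)} :
    IsIrreducibleSet Z ↔ (vanishingIdeal K Z).IsPrime := by
  let _ := zariskiTopology K σ
  change IsIrreducible Z ↔ _
  rw [IsIrreducible, isPreirreducible_iff_isClosed_union_isClosed]
  constructor
  · rintro ⟨⟨z, hz⟩, h⟩
    refine ⟨fun htop => ?_, fun {f g} hfg => ?_⟩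
    · have h1 : (1 : MvPolynomial σ K) ∈ vanishingIdeal K Z := htop ▸ Submodule.mem_top
      simpa using h1 z hz
    · have hcl (f : MvPolynomial σ K) : IsClosed (zeroLocus K (Ideal.span {f})) :=
        isClosed_zariskiTopology_iff.mpr ⟨_, rfl⟩
      have hmem (f : MvPolynomial σ K) (x : σ → K) :
          x ∈ zeroLocus K (Ideal.span {f}) ↔ aeval x f = 0 := by
        simp [zeroLocus_span]
      have := h _ _ (hcl f) (hcl g) fun x hx => by
        rw [Set.mem_union, hmem, hmem, ← mul_eq_zero, ← map_mul]
        exact hfg x hx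
      exact this.imp (fun h x hx => (hmem f x).mp (h hx)) (fun h x hx => (hmem g x).mp (h hx))
  · intro hP
    refine ⟨?_, fun C D hC hD hZ => ?_⟩
    · rw [Set.nonempty_iff_ne_empty]
      rintro rfl
      exact hP.ne_top vanishingIdeal_empty
    · obtain ⟨I, rfl⟩ := isClosed_zariskiTopology_iff.mp hC
      obtain ⟨J, rfl⟩ := isClosed_zariskiTopology_iff.mp hD
      rw [or_iff_not_imp_left, Set.not_subset]
      rintro ⟨z, hz, hzI⟩
      obtain ⟨f, hf, hfz⟩ : ∃ f ∈ I, aeval z f ≠ 0 := by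
        simpa [mem_zeroLocus_iff] using hzI
      intro x hx g hg
      have hfg : f * g ∈ vanishingIdeal K Z := by
        intro y hy
        rw [map_mul, mul_eq_zero]
        exact (hZ hy).imp (fun h => h f hf) (fun h => h g hg)
      exact (hP.mem_or_mem hfg).resolve_left (fun h => hfz (h z hz)) x hx

theorem isIrreducible_of_isIrreducible_image_val {X : Type*} [TopologicalSpace X] {V : Set X}
    {Z : Set V} (h : IsIrreducible (Subtype.val '' Z)) : IsIrreducible Z := by
  refine ⟨Set.image_nonempty.mp h.1, ?_⟩
  rw [isPreirreducible_iff_isClosed_union_isClosed]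
  intro C D hC hD hZ
  obtain ⟨C', hC', rfl⟩ := isClosed_induced_iff.mp hC
  obtain ⟨D', hD', rfl⟩ := isClosed_induced_iff.mp hD
  simp only [← Set.image_subset_iff]
  refine isPreirreducible_iff_isClosed_union_isClosed.mp h.2 C' D' hC' hD' ?_
  rwa [Set.image_subset_iff]

/-- By the Nullstellensatz, irreducible closed subsets of `V` correspond, with order reversed, to
primes containing `I(V)`. A strictly monotone map in each direction suffices to compare the two
dimensions. -/
theorem dimension_eq_ringKrullDim {K σ : Type*} [Field K] [IsAlgClosed K] [Finite σ]
    {V : Set (σ → K)} (hV : IsAlgebraicSet V) :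
    dimension V = ringKrullDim (CoordinateRing V) := by
  let _ := zariskiTopology K σ
  change Order.krullDim (TopologicalSpace.IrreducibleCloseds V) = Order.krullDim _
  rw [Order.krullDim_eq_of_orderIso (vanishingIdeal K V).primeSpectrumQuotientOrderIsoZeroLocus,
    ← Order.krullDim_orderDual
      (α := PrimeSpectrum.zeroLocus (vanishingIdeal K V : Set (MvPolynomial σ K)))]
  have hVc : IsClosed V := isClosed_zariskiTopology_iff.mpr hV
  have himage (Z : TopologicalSpace.IrreducibleCloseds V) :
      zeroLocus K (vanishingIdeal K (Subtype.val '' (Z : Set V))) = Subtype.val '' (Z : Set V) :=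
    (isClosed_zariskiTopology_iff.mp
      (hVc.isClosedMap_subtype_val _ Z.isClosed)).zeroLocus_vanishingIdeal
  have hloc (P : (PrimeSpectrum.zeroLocus (vanishingIdeal K V : Set (MvPolynomial σ K)))) :
      Subtype.val '' (Subtype.val ⁻¹' zeroLocus K P.1.asIdeal : Set V)
        = zeroLocus K P.1.asIdeal := by
    rw [Subtype.image_preimage_coe, Set.inter_eq_right]
    conv_rhs => rw [← hV.zeroLocus_vanishingIdeal]
    exact zeroLocus_anti_mono P.2
  refine le_antisymm (Order.krullDim_le_of_strictMono (fun Z => OrderDual.toDual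
      ⟨⟨vanishingIdeal K (Subtype.val '' (Z : Set V)), ?_⟩, ?_⟩) ?_)
    (Order.krullDim_le_of_strictMono (fun P =>
      ⟨Subtype.val ⁻¹' zeroLocus K (OrderDual.ofDual P).1.asIdeal, ?_, ?_⟩) ?_)
  · exact isIrreducibleSet_iff_isPrime_vanishingIdeal.mp
      (Z.isIrreducible.image _ continuous_subtype_val.continuousOn)
  · exact vanishingIdeal_anti_mono (Subtype.coe_image_subset _ _)
  · refine Monotone.strictMono_of_injective ?_ ?_
    · intro Z Z' h
      exact vanishingIdeal_anti_mono (Set.image_mono h)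
    · intro Z Z' h
      have h' : vanishingIdeal K (Subtype.val '' (Z : Set V)) =
          vanishingIdeal K (Subtype.val '' (Z' : Set V)) :=
        congrArg (fun P => (OrderDual.ofDual P).1.asIdeal) h
      have h2 := himage Z
      rw [h', himage Z'] at h2
      exact TopologicalSpace.IrreducibleCloseds.ext
        (Set.image_injective.mpr Subtype.val_injective h2.symm)
  · refine isIrreducible_of_isIrreducible_image_val ?_
    rw [hloc]
    refine isIrreducibleSet_iff_isPrime_vanishingIdeal.mpr ?_
    rw [IsPrime.vanishingIdeal_zeroLocus]
    exact P.1.isPrime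
  · exact (isClosed_zariskiTopology_iff.mpr ⟨_, rfl⟩).preimage continuous_subtype_val
  · refine Monotone.strictMono_of_injective ?_ ?_
    · intro P Q h
      have h' : (OrderDual.ofDual Q).1.asIdeal ≤ (OrderDual.ofDual P).1.asIdeal := h
      exact Set.preimage_mono (f := Subtype.val) (zeroLocus_anti_mono h')
    · intro P Q h
      have h1 : (Subtype.val ⁻¹' zeroLocus K (OrderDual.ofDual P).1.asIdeal : Set V) =
          Subtype.val ⁻¹' zeroLocus K (OrderDual.ofDual Q).1.asIdeal :=
        congrArg TopologicalSpace.IrreducibleCloseds.carrier h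
      have h2 := congrArg (fun Z => vanishingIdeal K (Subtype.val '' Z)) h1
      simp only [hloc] at h2
      rw [IsPrime.vanishingIdeal_zeroLocus, IsPrime.vanishingIdeal_zeroLocus] at h2
      exact Subtype.ext (PrimeSpectrum.ext h2)

end AffineVariety

/-! ### Tangent spaces and embedding dimension. -/

theorem IsLocalRing.maximalIdeal_le_of_le_sup_sq {R : Type*} [CommRing R] [IsLocalRing R]
    [IsNoetherianRing R] {N : Ideal R} (h : maximalIdeal R ≤ N ⊔ maximalIdeal R ^ 2) :
    maximalIdeal R ≤ N := by
  refine Submodule.le_of_le_smul_of_le_jacobson_bot (IsNoetherian.noetherian _)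
    (maximalIdeal_le_jacobson ⊥) ?_
  rwa [smul_eq_mul, ← pow_two]

/-- Some coordinate subspace is a complement of a given subspace of `K^σ`. -/
theorem Submodule.exists_finset_single_complement {K σ : Type*} [Field K] [Fintype σ]
    [DecidableEq σ] (W : Submodule K (σ → K)) :
    ∃ S : Finset σ, Module.finrank K W + S.card = Fintype.card σ ∧
      ∀ i, ∃ c : σ → K, (∀ j ∉ S, c j = 0) ∧ Pi.single i 1 - c ∈ W := by
  classical
  let v : σ → (σ → K) ⧸ W := fun i => W.mkQ (Pi.single i 1)
  have hv : Submodule.span K (Set.range v) = ⊤ := by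
    have h1 : Set.range v = W.mkQ '' Set.range (fun i : σ => Pi.single i (1 : K)) := by
      rw [← Set.range_comp]
      rfl
    have h2 : Submodule.span K (Set.range fun i : σ => (Pi.single i (1 : K) : σ → K)) = ⊤ := by
      have h3 : (fun i : σ => (Pi.single i (1 : K) : σ → K)) = Pi.basisFun K σ :=
        funext fun i => (Pi.basisFun_apply K σ i).symm
      rw [h3, (Pi.basisFun K σ).span_eq]
    rw [h1, Submodule.span_image, h2, Submodule.map_top, Submodule.range_mkQ]
  -- The standard vectors span the quotient by `W`; those indexed by `b` form a basis of it.
  obtain ⟨b, -, -, hb, hli⟩ := exists_linearIndepOn_extension (linearIndepOn_empty K v)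
    (Set.empty_subset Set.univ)
  have hspan : Submodule.span K (v '' b) = ⊤ := by
    rw [eq_top_iff, ← hv, Submodule.span_le, ← Set.image_univ]
    exact hb
  refine ⟨b.toFinset, ?_, fun i => ?_⟩
  · have h1 := finrank_span_eq_card (R := K) hli
    have h2 : Set.range (fun x : b => v x) = v '' b := (Set.image_eq_range v b).symm
    rw [h2, hspan, finrank_top] at h1
    have h3 := W.finrank_quotient_add_finrank
    rw [h1, Module.finrank_fintype_fun_eq_card] at h3
    rw [Set.toFinset_card, ← h3, add_comm]
  · have hi : v i ∈ Submodule.span K (v '' b) := hspan ▸ Submodule.mem_top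
    obtain ⟨l, hl, hli⟩ := (Finsupp.mem_span_image_iff_linearCombination K).mp hi
    refine ⟨l, fun j hj => ?_, ?_⟩
    · by_contra h
      exact hj (Set.mem_toFinset.mpr (hl (Finsupp.mem_support_iff.mpr h)))
    · rw [← Submodule.Quotient.eq]
      change v i = W.mkQ l
      have h4 : (l : σ → K) = ∑ j, l j • Pi.single j (1 : K) := by
        ext k
        simp [Finset.sum_apply, Pi.single_apply]
      rw [h4, map_sum, ← hli, Finsupp.linearCombination_apply, Finsupp.sum_fintype _ _ (by simp)]
      simp [v]

namespace AffineVariety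

/-- The gradient at `p` of a polynomial, as a linear map. -/
noncomputable def gradAt {K σ : Type*} [Field K] (p : σ → K) : MvPolynomial σ K →ₗ[K] (σ → K) :=
  LinearMap.pi fun i => (aeval p : MvPolynomial σ K →ₐ[K] K).toLinearMap ∘ₗ
    (pderiv i).toLinearMap

theorem gradAt_apply {K σ : Type*} [Field K] (p : σ → K) (f : MvPolynomial σ K) (i : σ) :
    gradAt p f i = eval p (pderiv i f) := rfl

/-- The space of the gradients at `p` of the polynomials vanishing on `W`. -/
noncomputable def normalSpace {K σ : Type*} [Field K] (W : Set (σ → K)) (p : σ → K) : Submodule K (σ → K) :=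
  ((vanishingIdeal K W).restrictScalars K).map (gradAt p)

/-- The tangent space is the orthogonal complement of the normal space for the dot product. -/
theorem finrank_normalSpace_add_finrank_tangentSpace {K σ : Type*} [Field K] [Fintype σ]
    (W : Set (σ → K)) (p : σ → K) :
    Module.finrank K (normalSpace W p) + Module.finrank K (tangentSpace W p) =
      Fintype.card σ := by
  classical
  have h : tangentSpace W p =
      ((normalSpace W p).map (dotProductEquiv K σ).toLinearMap).dualCoannihilator := by
    ext y
    simp only [normalSpace, Submodule.mem_dualCoannihilator, Submodule.mem_map]
    constructor
    · rintro hy _ ⟨_, ⟨f, hf, rfl⟩, rfl⟩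
      exact hy f hf
    · intro hy f hf
      exact hy _ ⟨_, ⟨f, hf, rfl⟩, rfl⟩
  have h2 := Subspace.finrank_add_finrank_dualCoannihilator_eq
    ((normalSpace W p).map (dotProductEquiv K σ).toLinearMap)
  rw [h, ← Module.finrank_fintype_fun_eq_card K (η := σ), ← h2]
  exact congrArg (· + _) (LinearEquiv.finrank_map_eq (dotProductEquiv K σ) _).symm

theorem gradDot_add {K σ : Type*} [Field K] [Fintype σ] (f g : MvPolynomial σ K) (p y : σ → K) :
    gradDot (f + g) p y = gradDot f p y + gradDot g p y := by
  simp [gradDot, add_mul, Finset.sum_add_distrib]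

theorem gradDot_mul {K σ : Type*} [Field K] [Fintype σ] (f g : MvPolynomial σ K) (p y : σ → K) :
    gradDot (f * g) p y = eval p f * gradDot g p y + eval p g * gradDot f p y := by
  simp only [gradDot, pderiv_mul, map_add, map_mul, Finset.mul_sum, ← Finset.sum_add_distrib]
  exact Finset.sum_congr rfl fun i _ => by ring

/-- The ideal of the polynomials that vanish at `p` to first order in the direction `y`. -/
def tangentIdeal {K σ : Type*} [Field K] [Fintype σ] (p y : σ → K) : Ideal (MvPolynomial σ K) where
  carrier := {f | eval p f = 0 ∧ gradDot f p y = 0}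
  zero_mem' := by simp [gradDot]
  add_mem' := by
    rintro f g ⟨hf, hf'⟩ ⟨hg, hg'⟩
    exact ⟨by simp [hf, hg], by rw [gradDot_add, hf', hg', add_zero]⟩
  smul_mem' := by
    rintro c f ⟨hf, hf'⟩
    exact ⟨by simp [hf], by rw [smul_eq_mul, gradDot_mul, hf, hf']; simp⟩

theorem mem_tangentIdeal {K σ : Type*} [Field K] [Fintype σ] {p y : σ → K}
    {f : MvPolynomial σ K} : f ∈ tangentIdeal p y ↔ eval p f = 0 ∧ gradDot f p y = 0 := Iff.rfl

theorem mk_mem_idealAt {K σ : Type*} [Field K] {W : Set (σ → K)} {p : W} {f : MvPolynomial σ K} :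
    Ideal.Quotient.mk (vanishingIdeal K W) f ∈ idealAt W p ↔ eval (p : σ → K) f = 0 := Iff.rfl

/-- A tangent vector `y` acts as the derivation `f ↦ ∇f(p) · y`, and is determined by its values on
numerators `a u` of generators of the maximal ideal. If these all vanish, some `s * (X j - p j)`
with `s(p) ≠ 0` lies in `tangentIdeal p y`, and the Leibniz rule gives `s(p) y_j = 0`. -/
theorem finrank_tangentSpace_le_spanFinrank {K σ : Type*} [Field K] [Fintype σ]
    (W : Set (σ → K)) (p : W) (R : Type*) [CommRing R] [IsLocalRing R]
    [Algebra (CoordinateRing W) R] [IsLocalization.AtPrime R (idealAt W p)] :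
    Module.finrank K (tangentSpace W p) ≤
      (IsLocalRing.maximalIdeal R).spanFinrank := by
  classical
  have hnoeth : IsNoetherianRing (R) :=
    IsLocalization.isNoetherianRing (idealAt W p).primeCompl _ inferInstance
  set m := IsLocalRing.maximalIdeal R
  have hfg : Submodule.FG m := IsNoetherian.noetherian m
  set G := m.generators
  have hG : G.Finite := Submodule.FG.finite_generators hfg
  have hGspan : Ideal.span G = m := m.span_generators
  have hfin : Fintype G := hG.fintype
  have hrep : ∀ u : G, ∃ a : MvPolynomial σ K, eval (p : σ → K) a = 0 ∧
      (u : R) ∈ Ideal.span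
        {algebraMap (CoordinateRing W) R (Ideal.Quotient.mk _ a)} := by
    intro u
    obtain ⟨x, s, hx⟩ := IsLocalization.exists_mk'_eq (idealAt W p).primeCompl (u : R)
    obtain ⟨a, rfl⟩ := Ideal.Quotient.mk_surjective x
    have hu : (u : R) ∈ m := hGspan ▸ Ideal.subset_span u.2
    refine ⟨a, ?_, ?_⟩
    · rw [← hx, IsLocalization.AtPrime.mk'_mem_maximal_iff R (idealAt W p)] at hu
      exact mk_mem_idealAt.mp hu
    · rw [Ideal.mem_span_singleton', ← hx]
      exact ⟨IsLocalization.mk' _ 1 s, by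
        rw [mul_comm, ← IsLocalization.mk'_eq_mul_mk'_one]⟩
  choose a ha hua using hrep
  let Φ : tangentSpace W p →ₗ[K] (G → K) :=
    { toFun := fun y u => gradDot (a u) p y
      map_add' := fun y z => by
        ext u
        simp [gradDot, mul_add, Finset.sum_add_distrib]
      map_smul' := fun c y => by
        ext u
        simp only [gradDot, Submodule.coe_smul, Pi.smul_apply, smul_eq_mul, RingHom.id_apply,
          Finset.mul_sum]
        exact Finset.sum_congr rfl fun i _ => by ring }
  have hker : LinearMap.ker Φ = ⊥ := by
    rw [LinearMap.ker_eq_bot']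
    intro y hy
    ext j
    let N : Ideal (CoordinateRing W) :=
      Ideal.span (Set.range fun u => Ideal.Quotient.mk (vanishingIdeal K W) (a u))
    have hN : m ≤ N.map (algebraMap (CoordinateRing W) (R)) := by
      rw [← hGspan, Ideal.span_le]
      intro u hu
      refine (Ideal.span_singleton_le_iff_mem _).mpr ?_ (hua ⟨u, hu⟩)
      exact Ideal.mem_map_of_mem _ (Ideal.subset_span ⟨_, rfl⟩)
    have hj : algebraMap (CoordinateRing W) (R)
        (Ideal.Quotient.mk _ (X j - C ((p : σ → K) j))) ∈ m := by
      rw [show m = _ from (IsLocalization.AtPrime.map_eq_maximalIdeal (idealAt W p) R).symm]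
      exact Ideal.mem_map_of_mem _ (mk_mem_idealAt.mpr (by simp))
    obtain ⟨s, hs, hsN⟩ := (IsLocalization.algebraMap_mem_map_algebraMap_iff
      (idealAt W p).primeCompl (R) N _).mp (hN hj)
    obtain ⟨s, rfl⟩ := Ideal.Quotient.mk_surjective s
    rw [← map_mul] at hsN
    have hle : N.comap (Ideal.Quotient.mk (vanishingIdeal K W)) ≤ tangentIdeal (p : σ → K) y := by
      have h1 : N = (Ideal.span (Set.range a)).map (Ideal.Quotient.mk (vanishingIdeal K W)) := by
        rw [Ideal.map_span, ← Set.range_comp]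
        rfl
      rw [h1, Ideal.comap_map_of_surjective _ Ideal.Quotient.mk_surjective, sup_le_iff,
        Ideal.span_le]
      constructor
      · rintro _ ⟨u, rfl⟩
        exact ⟨ha u, congrFun hy u⟩
      · intro f hf
        have hf' : f ∈ vanishingIdeal K W := by
          rwa [Ideal.mem_comap, Ideal.mem_bot, Ideal.Quotient.eq_zero_iff_mem] at hf
        exact ⟨hf' p p.2, y.2 f hf'⟩
    have h2 := (mem_tangentIdeal.mp (hle hsN)).2
    rw [gradDot_mul] at h2
    have h3 : gradDot (X j - C ((p : σ → K) j)) p (y : σ → K) = (y : σ → K) j := by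
      simp [gradDot, pderiv_X, Pi.single_apply]
    have h4 : eval (p : σ → K) s ≠ 0 := fun h => hs (mk_mem_idealAt.mpr h)
    rw [h3] at h2
    simpa [h4] using h2
  have h5 := LinearMap.finrank_le_finrank_of_injective (LinearMap.ker_eq_bot.mp hker)
  rw [Module.finrank_fintype_fun_eq_card] at h5
  rw [← Submodule.FG.generators_ncard hfg, ← Nat.card_coe_set_eq, Nat.card_eq_fintype_card]
  exact h5

/-- Taylor expansion to first order. -/
theorem sub_taylor_mem {K σ : Type*} [Field K] [Fintype σ] (p : σ → K) (f : MvPolynomial σ K) :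
    f - C (eval p f) - ∑ j, C (gradAt p f j) * (X j - C (p j)) ∈
      (Ideal.span (Set.range fun j => X j - C (p j)) : Ideal (MvPolynomial σ K)) ^ 2 := by
  classical
  set M : Ideal (MvPolynomial σ K) := Ideal.span (Set.range fun j => X j - C (p j))
  have hM (j : σ) : X j - C (p j) ∈ M := Ideal.subset_span ⟨j, rfl⟩
  induction f using MvPolynomial.induction_on with
  | C a => simp [gradAt_apply]
  | add f g hf hg =>
    have := add_mem hf hg
    convert this using 1
    simp only [map_add, Pi.add_apply, add_mul, Finset.sum_add_distrib]
    ring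
  | mul_X f k hf =>
    have h1 : (∑ j, C (gradAt p f j) * (X j - C (p j))) * (X k - C (p k)) ∈ M ^ 2 := by
      rw [pow_two]
      exact Ideal.mul_mem_mul (Ideal.sum_mem _ fun j _ => Ideal.mul_mem_left _ _ (hM j)) (hM k)
    have h2 := add_mem h1 (Ideal.mul_mem_right (X k) _ hf)
    convert h2 using 1
    have h3 : ∑ j, C (gradAt p (f * X k) j) * (X j - C (p j)) =
        C (p k) * ∑ j, C (gradAt p f j) * (X j - C (p j)) + C (eval p f) * (X k - C (p k)) := by
      simp only [gradAt_apply, pderiv_mul, pderiv_X, map_add, map_mul, eval_X, add_mul,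
        Finset.sum_add_distrib, Finset.mul_sum, Pi.single_apply]
      refine congrArg₂ (· + ·) (Finset.sum_congr rfl fun j _ => by ring) ?_
      rw [Finset.sum_eq_single k (fun j _ hj => by simp [hj.symm]) (by simp)]
      simp
    rw [h3, map_mul, eval_X, map_mul]
    ring

/-- Let the coordinates in `S` complement the normal space, so that `|S| = dim T_pW`. For each `i`
some `f ∈ I(W)` has gradient `e_i - c` at `p` with `c` supported on `S`; its Taylor expansion writes
`X i - p i` through the coordinates in `S` modulo the square of the maximal ideal. By Nakayama those
coordinates generate it. -/
theorem spanFinrank_le_finrank_tangentSpace_of_ringHom {K σ R : Type*} [Field K] [Fintype σ]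
    [CommRing R] [IsLocalRing R] [IsNoetherianRing R] {W : Set (σ → K)} {p : σ → K} (hp : p ∈ W)
    (π : MvPolynomial σ K →+* R) (hπ : ∀ f ∈ vanishingIdeal K W, π f = 0)
    (hmax : (Ideal.span (Set.range fun j => X j - C (p j))).map π = IsLocalRing.maximalIdeal R) :
    (IsLocalRing.maximalIdeal R).spanFinrank ≤ Module.finrank K (tangentSpace W p) := by
  classical
  obtain ⟨S, hScard, hS⟩ := (normalSpace W p).exists_finset_single_complement
  have hcard : S.card = Module.finrank K (tangentSpace W p) := by
    have := finrank_normalSpace_add_finrank_tangentSpace W p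
    omega
  let N : Ideal R := Ideal.span ((fun j => π (X j - C (p j))) '' (S : Set σ))
  have hmN : IsLocalRing.maximalIdeal R ≤ N := by
    refine IsLocalRing.maximalIdeal_le_of_le_sup_sq ?_
    nth_rw 1 [← hmax]
    rw [Ideal.map_span, Ideal.span_le]
    rintro _ ⟨_, ⟨i, rfl⟩, rfl⟩
    obtain ⟨c, hc, f, hf, hfc⟩ := hS i
    have h1 := Ideal.mem_map_of_mem π (sub_taylor_mem p f)
    have hfp : eval p f = 0 := hf p hp
    rw [Ideal.map_pow, hmax, hfc, hfp, map_zero, sub_zero, map_sub, hπ f hf, zero_sub,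
      neg_mem_iff] at h1
    have h2 : ∑ j, C ((Pi.single i 1 - c : σ → K) j) * (X j - C (p j)) =
        (X i - C (p i)) - ∑ j, C (c j) * (X j - C (p j)) := by
      simp [sub_mul, Finset.sum_sub_distrib, Pi.single_apply]
    rw [h2, map_sub] at h1
    have h3 : π (∑ j, C (c j) * (X j - C (p j))) ∈ N := by
      rw [map_sum]
      refine Ideal.sum_mem _ fun j _ => ?_
      by_cases hj : j ∈ S
      · rw [map_mul]
        exact Ideal.mul_mem_left _ _ (Ideal.subset_span ⟨j, hj, rfl⟩)
      · simp [hc j hj]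
    exact Submodule.mem_sup.mpr ⟨_, h3, _, h1, by ring⟩
  have hNm : N ≤ IsLocalRing.maximalIdeal R := by
    rw [← hmax, Ideal.span_le]
    rintro _ ⟨j, -, rfl⟩
    exact Ideal.mem_map_of_mem _ (Ideal.subset_span ⟨j, rfl⟩)
  rw [le_antisymm hmN hNm, ← hcard, ← Set.ncard_coe_finset]
  exact (Submodule.spanFinrank_span_le_ncard_of_finite (S.finite_toSet.image _)).trans
    (Set.ncard_image_le S.finite_toSet)

theorem map_span_X_sub_C_eq_idealAt {K σ : Type*} [Field K] [Fintype σ] (W : Set (σ → K))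
    (p : W) :
    (Ideal.span (Set.range fun j => X j - C ((p : σ → K) j))).map
      (Ideal.Quotient.mk (vanishingIdeal K W)) = idealAt W p := by
  refine le_antisymm ?_ ?_
  · rw [Ideal.map_span, Ideal.span_le]
    rintro _ ⟨_, ⟨j, rfl⟩, rfl⟩
    exact mk_mem_idealAt.mpr (by simp)
  · intro x hx
    obtain ⟨f, rfl⟩ := Ideal.Quotient.mk_surjective x
    refine Ideal.mem_map_of_mem _ ?_
    have h1 := Ideal.pow_le_self two_ne_zero (sub_taylor_mem (p : σ → K) f)
    rw [mk_mem_idealAt.mp hx, map_zero, sub_zero] at h1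
    refine (Submodule.sub_mem_iff_left _ ?_).mp h1
    exact Ideal.sum_mem _ fun j _ => Ideal.mul_mem_left _ _ (Ideal.subset_span ⟨j, rfl⟩)

theorem spanFinrank_le_finrank_tangentSpace {K σ : Type*} [Field K] [Fintype σ]
    (W : Set (σ → K)) (p : W) (R : Type*) [CommRing R] [IsLocalRing R]
    [Algebra (CoordinateRing W) R] [IsLocalization.AtPrime R (idealAt W p)] :
    (IsLocalRing.maximalIdeal R).spanFinrank ≤ Module.finrank K (tangentSpace W p) := by
  have hnoeth : IsNoetherianRing R :=
    IsLocalization.isNoetherianRing (idealAt W p).primeCompl _ inferInstance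
  refine spanFinrank_le_finrank_tangentSpace_of_ringHom p.2
    ((algebraMap (CoordinateRing W) R).comp (Ideal.Quotient.mk _)) ?_ ?_
  · intro f hf
    rw [RingHom.comp_apply, Ideal.Quotient.eq_zero_iff_mem.mpr hf, map_zero]
  · rw [← Ideal.map_map, map_span_X_sub_C_eq_idealAt]
    exact IsLocalization.AtPrime.map_eq_maximalIdeal (idealAt W p) R

theorem finrank_tangentSpace_eq_of_isRegularLocalRing {K σ : Type*} [Field K] [Fintype σ]
    {W : Set (σ → K)} (p : W) (R : Type*) [CommRing R] [Algebra (CoordinateRing W) R]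
    [IsLocalization.AtPrime R (idealAt W p)] [IsRegularLocalRing R] {d : ℕ}
    (hd : ringKrullDim R = d) : Module.finrank K (tangentSpace W p) = d := by
  have h1 := IsRegularLocalRing.spanFinrank_maximalIdeal (R := R)
  rw [hd] at h1
  have h2 : (IsLocalRing.maximalIdeal R).spanFinrank = d := by exact_mod_cast h1
  exact le_antisymm ((finrank_tangentSpace_le_spanFinrank W p R).trans h2.le)
    (h2.ge.trans (spanFinrank_le_finrank_tangentSpace W p R))

/-! ### Splitting the differentials when the tangent spaces have constant dimension. -/

/-- The gradient of a polynomial as a vector of regular functions on `V`. -/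
noncomputable def gradOn {K σ : Type*} [Field K] (V : Set (σ → K)) (f : MvPolynomial σ K) :
    σ → CoordinateRing V :=
  fun i => Ideal.Quotient.mk _ (pderiv i f)

theorem evalAt_mk {K σ : Type*} [Field K] (V : Set (σ → K)) (p : V) (f : MvPolynomial σ K) :
    evalAt V p (Ideal.Quotient.mk _ f) = eval (p : σ → K) f := rfl

theorem eq_zero_of_forall_evalAt {K σ : Type*} [Field K] {V : Set (σ → K)} {a : CoordinateRing V}
    (h : ∀ p, evalAt V p a = 0) : a = 0 := by
  obtain ⟨f, rfl⟩ := Ideal.Quotient.mk_surjective a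
  rw [Ideal.Quotient.eq_zero_iff_mem]
  exact fun x hx => h ⟨x, hx⟩

/-- The module of the relations between the differentials of the coordinates on `V`. -/
noncomputable def relationModule {K σ : Type*} [Field K] (V : Set (σ → K)) :
    Submodule (CoordinateRing V) (σ → CoordinateRing V) :=
  Submodule.span _ (gradOn V '' vanishingIdeal K V)

/-- The matrix `E` gives a linear map on `K[V]^σ` that kills all relations and is congruent to
multiplication by `a` modulo the relations. -/
def SplitsAlong {K σ : Type*} [Field K] [Fintype σ] [DecidableEq σ] (V : Set (σ → K))
    (a : CoordinateRing V) (E : Matrix σ σ (CoordinateRing V)) : Prop :=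
  (∀ f ∈ vanishingIdeal K V, Matrix.vecMul (gradOn V f) E = 0) ∧
    ∀ i, a • Pi.single i 1 - E i ∈ relationModule V

/-- The ideal of the functions along which the differentials split off. -/
noncomputable def splittingIdeal {K σ : Type*} [Field K] [Fintype σ] [DecidableEq σ]
    (V : Set (σ → K)) : Ideal (CoordinateRing V) where
  carrier := {a | ∃ E, SplitsAlong V a E}
  zero_mem' := ⟨0, fun f _ => by simp, fun i => by
    convert zero_mem (relationModule V) using 1
    ext j
    simp⟩
  add_mem' := by
    rintro a b ⟨E, hE, hE'⟩ ⟨F, hF, hF'⟩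
    refine ⟨E + F, fun f hf => by rw [Matrix.vecMul_add, hE f hf, hF f hf, add_zero], fun i => ?_⟩
    have := add_mem (hE' i) (hF' i)
    convert this using 1
    rw [add_smul]
    change _ - (E i + F i) = _
    abel
  smul_mem' := by
    rintro c a ⟨E, hE, hE'⟩
    refine ⟨c • E, fun f hf => by rw [Matrix.vecMul_smul, hE f hf, smul_zero], fun i => ?_⟩
    have := Submodule.smul_mem _ c (hE' i)
    rwa [smul_sub, smul_smul] at this

/-- Near `p` the tangent spaces are parametrized by the coordinates in `S`; clearing the denominator
`a` from this parametrization gives `E`. The last clause serves the lower bound for `dim TV`. -/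
theorem exists_splitsAlong {K σ : Type*} [Field K] [Fintype σ] [DecidableEq σ]
    {V : Set (σ → K)} [IsDomain (CoordinateRing V)] {d : ℕ}
    (hd : ∀ p : V, Module.finrank K (tangentSpace V p) = d) (p : V) :
    ∃ (S : Finset σ) (a : CoordinateRing V) (E : Matrix σ σ (CoordinateRing V)),
      S.card = d ∧ evalAt V p a ≠ 0 ∧ SplitsAlong V a E ∧ ∀ s ∈ S, E s = a • Pi.single s 1 := by
  obtain ⟨S, hScard, hS⟩ := (normalSpace V (p : σ → K)).exists_finset_single_complement
  have hSd : S.card = d := by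
    have := finrank_normalSpace_add_finrank_tangentSpace V (p : σ → K)
    have := hd p
    omega
  choose c hc hcW using hS
  choose f hf hfc using hcW
  let B : Matrix σ σ (CoordinateRing V) := fun i => if i ∈ S then Pi.single i 1 else gradOn V (f i)
  have hBS {i} (hi : i ∈ S) : B i = Pi.single i 1 := if_pos hi
  have hBn {i} (hi : i ∉ S) : B i = gradOn V (f i) := if_neg hi
  let ev (q : V) (v : σ → CoordinateRing V) : σ → K := fun i => evalAt V q (v i)
  have hevgrad (q : V) (g) : ev q (gradOn V g) = gradAt (q : σ → K) g := rfl
  have hevsingle (q : V) (i : σ) : ev q (Pi.single i 1) = Pi.single i 1 := by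
    ext j
    simp only [ev, Pi.single_apply]
    split_ifs <;> simp
  -- the determinant does not vanish at `p`
  have hdet : evalAt V p B.det ≠ 0 := by
    have h1 : evalAt V p B.det = (B.map (evalAt V p)).det := AlgHom.map_det _ _
    rw [h1, ← isUnit_iff_ne_zero, ← Matrix.isUnit_iff_isUnit_det,
      ← Matrix.linearIndependent_rows_iff_isUnit]
    refine linearIndependent_of_top_le_span_of_card_eq_finrank ?_ (by simp)
    have hrow (i : σ) : (B.map (evalAt V p)).row i = ev p (B i) := rfl
    set T := Submodule.span K (Set.range (B.map (evalAt V p)).row)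
    have hTS {i : σ} (hi : i ∈ S) : (Pi.single i 1 : σ → K) ∈ T := by
      refine Submodule.subset_span ⟨i, ?_⟩
      rw [hrow, hBS hi, hevsingle]
    have hT (i : σ) : (Pi.single i 1 : σ → K) ∈ T := by
      by_cases hi : i ∈ S
      · exact hTS hi
      · have h2 : Pi.single i 1 - c i ∈ T := by
          refine Submodule.subset_span ⟨i, ?_⟩
          rw [hrow, hBn hi, hevgrad, hfc]
        have h3 : c i ∈ T := by
          rw [pi_eq_sum_univ' (c i)]
          refine Submodule.sum_mem _ fun j _ => ?_
          by_cases hj : j ∈ S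
          · refine Submodule.smul_mem _ _ ?_
            convert hTS hj using 1
          · rw [hc i j hj, zero_smul]
            exact zero_mem _
        simpa using add_mem h2 h3
    rw [← (Pi.basisFun K σ).span_eq, Submodule.span_le]
    rintro _ ⟨i, rfl⟩
    rw [Pi.basisFun_apply]
    exact hT i
  have hdet0 : B.det ≠ 0 := fun h => hdet (by rw [h, map_zero])
  -- at every point of `V` where the determinant does not vanish,
  -- the columns of the adjugate belonging to `S` are tangent vectors
  have htangent : ∀ g ∈ vanishingIdeal K V, ∀ s ∈ S,
      Matrix.vecMul (gradOn V g) B.adjugate s = 0 := by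
    intro g hg s hs
    refine (mul_eq_zero.mp (show B.det * _ = 0 from ?_)).resolve_left hdet0
    refine eq_zero_of_forall_evalAt fun q => ?_
    rw [map_mul, mul_eq_zero, or_iff_not_imp_left]
    intro hq
    -- Where `det B ≠ 0`, a tangent vector is determined by its coordinates in `S`. Both spaces have
    -- dimension `d`, so some tangent `y` satisfies `B(q) y = e_s`, and Cramer's rule identifies
    -- column `s` of the adjugate with `det B(q) • y`.
    let res : tangentSpace V (q : σ → K) →ₗ[K] (S → K) :=
      (LinearMap.funLeft K K Subtype.val).comp (tangentSpace V (q : σ → K)).subtype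
    have hBq : IsUnit (B.map (evalAt V q)) := by
      rw [Matrix.isUnit_iff_isUnit_det, isUnit_iff_ne_zero]
      have h1 : evalAt V q B.det = (B.map (evalAt V q)).det := AlgHom.map_det _ _
      rwa [← h1]
    have hmulVec (y : tangentSpace V (q : σ → K)) (i : σ) :
        (B.map (evalAt V q)).mulVec y i = if i ∈ S then (y : σ → K) i else 0 := by
      have h1 : (B.map (evalAt V q)).mulVec y i = ev q (B i) ⬝ᵥ y := rfl
      rw [h1]
      split_ifs with hi
      · rw [hBS hi, hevsingle, single_one_dotProduct]
      · rw [hBn hi, hevgrad]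
        exact y.2 (f i) (hf i)
    have hinj : Function.Injective res := by
      rw [← LinearMap.ker_eq_bot, LinearMap.ker_eq_bot']
      intro y hy
      have h1 : (B.map (evalAt V q)).mulVec y = 0 := by
        ext i
        rw [hmulVec]
        split_ifs with hi
        · exact congrFun hy ⟨i, hi⟩
        · rfl
      have h2 := (Matrix.mulVec_injective_iff_isUnit.mpr hBq) (h1.trans (Matrix.mulVec_zero _).symm)
      exact Subtype.ext h2
    have hsurj : Function.Surjective res := by
      refine (LinearMap.injective_iff_surjective_of_finrank_eq_finrank ?_).mp hinj
      rw [hd q, Module.finrank_fintype_fun_eq_card, Fintype.card_coe, hSd]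
    obtain ⟨y, hy⟩ := hsurj (Pi.single ⟨s, hs⟩ 1)
    have h1 : (B.map (evalAt V q)).mulVec y = Pi.single s 1 := by
      ext i
      rw [hmulVec]
      split_ifs with hi
      · refine (congrFun hy ⟨i, hi⟩).trans ?_
        simp [Pi.single_apply]
      · rw [Pi.single_eq_of_ne]
        rintro rfl
        exact hi hs
    have h2 : (B.map (evalAt V q)).adjugate.mulVec (Pi.single s 1) =
        evalAt V q B.det • (y : σ → K) := by
      have h3 : evalAt V q B.det = (B.map (evalAt V q)).det := AlgHom.map_det _ _
      rw [← h1, Matrix.mulVec_mulVec, Matrix.adjugate_mul, Matrix.smul_mulVec, Matrix.one_mulVec,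
        h3]
    have h4 : evalAt V q (Matrix.vecMul (gradOn V g) B.adjugate s) =
        gradAt (q : σ → K) g ⬝ᵥ (B.map (evalAt V q)).adjugate.mulVec (Pi.single s 1) := by
      have h5 : (B.map (evalAt V q)).adjugate = B.adjugate.map (evalAt V q) :=
        (AlgHom.map_adjugate _ _).symm
      rw [h5, Matrix.mulVec_single_one, Matrix.vecMul, dotProduct, dotProduct, map_sum]
      exact Finset.sum_congr rfl fun i _ => map_mul _ _ _
    rw [h4, h2, dotProduct_smul]
    have h6 : gradAt (q : σ → K) g ⬝ᵥ (y : σ → K) = 0 := y.2 g hg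
    rw [h6, smul_zero]
  -- Discarding the columns outside `S` drops exactly the gradient terms from `adj(B) * B = det B`,
  -- so `det B • e_i - E i` is a combination of gradients.
  let E : Matrix σ σ (CoordinateRing V) := fun i j => if j ∈ S then B.adjugate i j else 0
  have hvecMul (v : σ → CoordinateRing V) (j : σ) :
      Matrix.vecMul v E j = if j ∈ S then Matrix.vecMul v B.adjugate j else 0 := by
    simp only [Matrix.vecMul, dotProduct, E]
    split_ifs <;> simp
  refine ⟨S, B.det, E, hSd, hdet, ⟨fun g hg => ?_, fun i => ?_⟩, fun s hs => ?_⟩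
  · ext j
    rw [hvecMul]
    split_ifs with hj
    · exact htangent g hg j hj
    · rfl
  · have h1 : B.det • Pi.single i 1 - E i = ∑ k, if k ∈ S then 0 else B.adjugate i k • B k := by
      have h2 : B.det • Pi.single i 1 = ∑ k, B.adjugate i k • B k := by
        have h3 := congrFun (Matrix.adjugate_mul B) i
        ext j
        have h4 := congrFun h3 j
        rw [Matrix.mul_apply] at h4
        simp only [Finset.sum_apply, Pi.smul_apply, smul_eq_mul]
        rw [h4]
        simp [Matrix.one_apply, Pi.single_apply, eq_comm]
      have h3 : E i = ∑ k, if k ∈ S then B.adjugate i k • B k else 0 := by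
        have h4 : (∑ k, if k ∈ S then B.adjugate i k • B k else 0) =
            ∑ k, if k ∈ S then B.adjugate i k • Pi.single k 1 else 0 :=
          Finset.sum_congr rfl fun k _ => by
            split_ifs with hk
            · rw [hBS hk]
            · rfl
        rw [h4]
        ext j
        rw [Finset.sum_apply, Finset.sum_eq_single j]
        · simp only [E]
          split_ifs <;> simp
        · intro k _ hk
          split_ifs
          · simp [hk.symm]
          · rfl
        · simp
      rw [h2, h3, ← Finset.sum_sub_distrib]
      exact Finset.sum_congr rfl fun k _ => by split_ifs <;> simp
    rw [h1]
    refine Submodule.sum_mem _ fun k _ => ?_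
    split_ifs with hk
    · exact zero_mem _
    · refine Submodule.smul_mem _ _ ?_
      rw [hBn hk]
      exact Submodule.subset_span ⟨f k, hf k, rfl⟩
  · have h1 : Matrix.vecMul (Pi.single s 1) B = Pi.single s 1 := by
      rw [Matrix.single_one_vecMul]
      exact hBS hs
    have h2 : Matrix.vecMul (Pi.single s 1) B.adjugate = B.det • Pi.single s 1 := by
      nth_rw 1 [← h1]
      rw [Matrix.vecMul_vecMul, Matrix.mul_adjugate, Matrix.vecMul_smul, Matrix.vecMul_one]
    have h3 : E s = Matrix.vecMul (Pi.single s 1) E := (Matrix.single_one_vecMul s E).symm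
    rw [h3]
    ext j
    rw [hvecMul, h2]
    split_ifs with hj
    · rfl
    · have : j ≠ s := fun h => hj (h ▸ hs)
      simp [this]

theorem exists_eq_idealAt {K σ : Type*} [Field K] [IsAlgClosed K] [Finite σ] {V : Set (σ → K)}
    (hV : IsAlgebraicSet V) (M : Ideal (CoordinateRing V)) (hM : M.IsMaximal) :
    ∃ p : V, M = idealAt V p := by
  have hM' : (M.comap (Ideal.Quotient.mk (vanishingIdeal K V))).IsMaximal :=
    Ideal.comap_isMaximal_of_surjective _ Ideal.Quotient.mk_surjective
  obtain ⟨x, hx⟩ := isMaximal_iff_eq_vanishingIdeal_singleton.mp hM'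
  have hxV : x ∈ V := by
    rw [← hV.zeroLocus_vanishingIdeal]
    intro f hf
    rw [← mem_vanishingIdeal_singleton_iff, ← hx, Ideal.mem_comap,
      Ideal.Quotient.eq_zero_iff_mem.mpr hf]
    exact M.zero_mem
  refine ⟨⟨x, hxV⟩, ?_⟩
  ext a
  obtain ⟨f, rfl⟩ := Ideal.Quotient.mk_surjective a
  rw [← Ideal.mem_comap, hx, mem_vanishingIdeal_singleton_iff]
  rfl

theorem idealAt_isMaximal {K σ : Type*} [Field K] (V : Set (σ → K)) (p : V) :
    (idealAt V p).IsMaximal :=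
  RingHom.ker_isMaximal_of_surjective _ fun c => ⟨algebraMap K _ c, (evalAt V p).commutes c⟩

/-- The local splittings show that `splittingIdeal V` lies in no `idealAt V p`. These are all the
maximal ideals, so it contains `1`. -/
theorem exists_splitsAlong_one {K σ : Type*} [Field K] [IsAlgClosed K] [Fintype σ] [DecidableEq σ]
    {V : Set (σ → K)} (hV : IsAlgebraicSet V) [IsDomain (CoordinateRing V)] {d : ℕ}
    (hd : ∀ p : V, Module.finrank K (tangentSpace V p) = d) :
    ∃ E : Matrix σ σ (CoordinateRing V), SplitsAlong V 1 E := by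
  have htop : splittingIdeal V = ⊤ := by
    by_contra h
    obtain ⟨M, hM, hle⟩ := Ideal.exists_le_maximal _ h
    obtain ⟨p, rfl⟩ := exists_eq_idealAt hV M hM
    obtain ⟨S, a, E, -, ha, hE, -⟩ := exists_splitsAlong hd p
    exact ha (hle ⟨E, hE⟩)
  have h1 : (1 : CoordinateRing V) ∈ splittingIdeal V := htop ▸ Submodule.mem_top
  exact h1

/-! ### The substitution `y ↦ E y` and the ideal of the tangent bundle. -/

/-- The linear form with given coefficients. -/
noncomputable def linForm {σ A : Type*} [CommRing A] [Fintype σ] :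
    (σ → A) →ₗ[A] MvPolynomial σ A :=
  Fintype.linearCombination A X

theorem linForm_apply {σ A : Type*} [CommRing A] [Fintype σ] (v : σ → A) :
    linForm v = ∑ i, v i • X i := rfl

theorem linForm_single {σ A : Type*} [CommRing A] [Fintype σ] [DecidableEq σ] (i : σ) :
    linForm (Pi.single i (1 : A)) = X i := by
  simp [linForm]

/-- The linear substitution `X i ↦ ∑ j, E i j * X j`. -/
noncomputable def linSubst {σ A : Type*} [CommRing A] [Fintype σ] (E : Matrix σ σ A) :
    MvPolynomial σ A →ₐ[A] MvPolynomial σ A :=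
  aeval fun i => linForm (E i)

/-- The polynomials in `x` and `y`, seen as polynomials in `y` over the coordinate ring. -/
noncomputable def toFiberPoly {K σ : Type*} [Field K] (V : Set (σ → K)) :
    MvPolynomial (σ ⊕ σ) K →ₐ[K] MvPolynomial σ (CoordinateRing V) :=
  aeval (Sum.elim (fun i => C (Ideal.Quotient.mk _ (X i))) X)

theorem toFiberPoly_inX {K σ : Type*} [Field K] (V : Set (σ → K)) (f : MvPolynomial σ K) :
    toFiberPoly V (inX f) = C (Ideal.Quotient.mk _ f) := by
  have h : (toFiberPoly V).comp (rename Sum.inl) =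
      (IsScalarTower.toAlgHom K (CoordinateRing V) (MvPolynomial σ (CoordinateRing V))).comp
        (Ideal.Quotient.mkₐ K (vanishingIdeal K V)) := by
    ext i : 1
    simp [toFiberPoly, algebraMap_eq]
  exact DFunLike.congr_fun h f

theorem toFiberPoly_gradY {K σ : Type*} [Field K] [Fintype σ] (V : Set (σ → K))
    (f : MvPolynomial σ K) : toFiberPoly V (gradY f) = linForm (gradOn V f) := by
  rw [gradY, map_sum, linForm_apply]
  refine Finset.sum_congr rfl fun i _ => ?_
  rw [map_mul, smul_eq_C_mul]
  refine congrArg₂ (· * ·) (toFiberPoly_inX V _) ?_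
  simp [toFiberPoly]

theorem eval₂_toFiberPoly {K σ : Type*} [Field K] (V : Set (σ → K)) (p : V) (y : σ → K)
    (F : MvPolynomial (σ ⊕ σ) K) :
    eval₂Hom (evalAt V p : CoordinateRing V →+* K) y (toFiberPoly V F) =
      eval (Sum.elim (p : σ → K) y) F := by
  have h : (eval₂Hom (evalAt V p : CoordinateRing V →+* K) y).comp
      (toFiberPoly V : _ →+* MvPolynomial σ (CoordinateRing V)) = eval (Sum.elim (p : σ → K) y) := by
    refine MvPolynomial.ringHom_ext (fun c => ?_) (fun i => ?_)
    · simp [toFiberPoly, MvPolynomial.algebraMap_apply]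
    · rcases i with i | i <;> simp [toFiberPoly, evalAt_mk]
  exact RingHom.congr_fun h F

theorem eval₂_linSubst {σ A K : Type*} [CommRing A] [Field K] [Fintype σ] (E : Matrix σ σ A)
    (φ : A →+* K) (y : σ → K) (G : MvPolynomial σ A) :
    eval₂Hom φ y (linSubst E G) = eval₂Hom φ ((E.map φ).mulVec y) G := by
  have h : (eval₂Hom φ y).comp (linSubst E : _ →+* MvPolynomial σ A) =
      eval₂Hom φ ((E.map φ).mulVec y) := by
    refine MvPolynomial.ringHom_ext (fun c => ?_) (fun i => ?_)
    · simp [linSubst, MvPolynomial.algebraMap_eq]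
    · simp [linSubst, linForm_apply, Matrix.mulVec, dotProduct, smul_eq_C_mul]
  exact RingHom.congr_fun h G

/-- For fixed `p` a polynomial function in `y` over an infinite field determines its coefficients,
and a regular function on `V` is determined by its values. -/
theorem eq_zero_of_forall_eval₂ {K σ : Type*} [Field K] [Infinite K] {V : Set (σ → K)}
    {G : MvPolynomial σ (CoordinateRing V)}
    (h : ∀ (p : V) (y : σ → K), eval₂Hom (evalAt V p : CoordinateRing V →+* K) y G = 0) :
    G = 0 := by
  ext m
  rw [coeff_zero]
  refine eq_zero_of_forall_evalAt fun p => ?_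
  have h1 : map (evalAt V p : CoordinateRing V →+* K) G = 0 :=
    MvPolynomial.funext fun y => by
      rw [eval_map, map_zero]
      exact h p y
  have h2 := congrArg (coeff m) h1
  rwa [coeff_map, coeff_zero] at h2

/-- The columns of `E` are tangent at every point, so `E(p) y` is tangent for arbitrary `y`. -/
theorem mem_tangentBundle_of_splits {K σ : Type*} [Field K] [Fintype σ] {V : Set (σ → K)}
    {E : Matrix σ σ (CoordinateRing V)}
    (hE : ∀ f ∈ vanishingIdeal K V, Matrix.vecMul (gradOn V f) E = 0) (p : V) (y : σ → K) :
    Sum.elim (p : σ → K) ((E.map (evalAt V p)).mulVec y) ∈ tangentBundle V := by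
  refine ⟨p.2, fun f hf => ?_⟩
  have h1 : Matrix.vecMul (gradAt (p : σ → K) f) (E.map (evalAt V p)) = 0 := by
    ext j
    have h2 := congrArg (evalAt V p) (congrFun (hE f hf) j)
    simp only [Matrix.vecMul, dotProduct, map_sum, map_mul, Pi.zero_apply, map_zero] at h2
    exact h2
  have h3 : gradAt (p : σ → K) f ⬝ᵥ (E.map (evalAt V p)).mulVec y = 0 := by
    rw [Matrix.dotProduct_mulVec, h1, zero_dotProduct]
  exact h3

theorem linSubst_toFiberPoly_eq_zero {K σ : Type*} [Field K] [Infinite K] [Fintype σ]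
    {V : Set (σ → K)} {E : Matrix σ σ (CoordinateRing V)}
    (hE : ∀ f ∈ vanishingIdeal K V, Matrix.vecMul (gradOn V f) E = 0)
    {F : MvPolynomial (σ ⊕ σ) K} (hF : F ∈ vanishingIdeal K (tangentBundle V)) :
    linSubst E (toFiberPoly V F) = 0 := by
  refine eq_zero_of_forall_eval₂ fun p y => ?_
  rw [eval₂_linSubst, eval₂_toFiberPoly]
  exact hF _ (mem_tangentBundle_of_splits hE p y)

/-- If `E` splits the differentials, a polynomial is congruent to its image under `linSubst E`
modulo the linear forms of the relations. -/
theorem mem_span_of_linSubst_eq_zero {K σ : Type*} [Field K] [Fintype σ] [DecidableEq σ] {V : Set (σ → K)}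
    {E : Matrix σ σ (CoordinateRing V)} (hE : SplitsAlong V 1 E)
    {G : MvPolynomial σ (CoordinateRing V)} (hG : linSubst E G = 0) :
    G ∈ Ideal.span (linForm '' (gradOn V '' vanishingIdeal K V)) := by
  set N := Ideal.span (linForm '' (gradOn V '' vanishingIdeal K V))
  have hlin {v} (hv : v ∈ relationModule V) : linForm v ∈ N := by
    induction hv using Submodule.span_induction with
    | mem v hv => exact Ideal.subset_span ⟨v, hv, rfl⟩
    | zero => simp
    | add v w _ _ hv hw => rw [map_add]; exact add_mem hv hw
    | smul a v _ hv => rw [map_smul, smul_eq_C_mul]; exact Ideal.mul_mem_left _ _ hv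
  have h : (Ideal.Quotient.mkₐ (CoordinateRing V) N).comp (linSubst E) =
      Ideal.Quotient.mkₐ (CoordinateRing V) N := by
    ext i : 1
    refine (Ideal.Quotient.eq.mpr ?_).symm
    have h1 : linForm ((1 : CoordinateRing V) • Pi.single i 1 - E i) = X i - linSubst E (X i) := by
      rw [map_sub, one_smul, linSubst, aeval_X, linForm_single]
    exact h1 ▸ hlin (hE.2 i)
  have h2 : Ideal.Quotient.mkₐ (CoordinateRing V) N (linSubst E G) =
      Ideal.Quotient.mkₐ (CoordinateRing V) N G := DFunLike.congr_fun h G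
  rw [hG, map_zero] at h2
  exact Ideal.Quotient.eq_zero_iff_mem.mp h2.symm

theorem inX_mem_of_mem_span {K σ ι : Type*} [Field K] {f : ι → MvPolynomial σ K}
    {J : Ideal (MvPolynomial (σ ⊕ σ) K)} (hf : ∀ i, inX (f i) ∈ J) {g : MvPolynomial σ K}
    (hg : g ∈ Ideal.span (Set.range f)) : inX g ∈ J := by
  have h : Ideal.span (Set.range f) ≤ J.comap (rename Sum.inl) := by
    rw [Ideal.span_le]
    rintro _ ⟨i, rfl⟩
    exact hf i
  exact h hg

theorem gradY_add {K σ : Type*} [Field K] [Fintype σ] (f g : MvPolynomial σ K) :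
    gradY (f + g) = gradY f + gradY g := by
  simp [gradY, add_mul, Finset.sum_add_distrib]

theorem gradY_mul {K σ : Type*} [Field K] [Fintype σ] (f g : MvPolynomial σ K) :
    gradY (f * g) = inX f * gradY g + inX g * gradY f := by
  simp only [gradY, inX, pderiv_mul, map_add, map_mul, Finset.mul_sum, ← Finset.sum_add_distrib]
  exact Finset.sum_congr rfl fun i _ => by ring

theorem gradY_mem_of_mem_span {K σ ι : Type*} [Field K] [Fintype σ] {f : ι → MvPolynomial σ K}
    {J : Ideal (MvPolynomial (σ ⊕ σ) K)} (hf : ∀ i, inX (f i) ∈ J) (hf' : ∀ i, gradY (f i) ∈ J)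
    {g : MvPolynomial σ K} (hg : g ∈ Ideal.span (Set.range f)) : gradY g ∈ J := by
  induction hg using Submodule.span_induction with
  | mem g hg => obtain ⟨i, rfl⟩ := hg; exact hf' i
  | zero => simp [gradY]
  | add g h _ _ hg hh => rw [gradY_add]; exact add_mem hg hh
  | smul a g hg ih =>
    rw [smul_eq_mul, gradY_mul]
    exact add_mem (Ideal.mul_mem_left _ _ ih)
      (Ideal.mul_mem_right _ _ (inX_mem_of_mem_span hf hg))

/-- Reduction modulo `J` factors through `toFiberPoly V`, because `J` contains `I(V)`; the factor
`ψ` kills the linear forms, which are images of the `gradY g`. -/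
theorem mem_of_toFiberPoly_mem {K σ : Type*} [Field K] [Fintype σ] {V : Set (σ → K)}
    {J : Ideal (MvPolynomial (σ ⊕ σ) K)} (hJ : ∀ g ∈ vanishingIdeal K V, inX g ∈ J)
    (hJ' : ∀ g ∈ vanishingIdeal K V, gradY g ∈ J) {F : MvPolynomial (σ ⊕ σ) K}
    (hF : toFiberPoly V F ∈ Ideal.span (linForm '' (gradOn V '' vanishingIdeal K V))) :
    F ∈ J := by
  let ρ : CoordinateRing V →+* MvPolynomial (σ ⊕ σ) K ⧸ J :=
    Ideal.Quotient.lift (vanishingIdeal K V)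
      ((Ideal.Quotient.mk J).comp (rename Sum.inl : MvPolynomial σ K →ₐ[K] _).toRingHom)
      fun g hg => Ideal.Quotient.eq_zero_iff_mem.mpr (hJ g hg)
  let ψ : MvPolynomial σ (CoordinateRing V) →+* MvPolynomial (σ ⊕ σ) K ⧸ J :=
    eval₂Hom ρ fun i => Ideal.Quotient.mk J (X (Sum.inr i))
  have hρ (g : MvPolynomial σ K) : ρ (Ideal.Quotient.mk _ g) = Ideal.Quotient.mk J (inX g) := rfl
  have h1 : ψ.comp (toFiberPoly V : _ →+* MvPolynomial σ (CoordinateRing V)) =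
      Ideal.Quotient.mk J := by
    refine MvPolynomial.ringHom_ext (fun c => ?_) (fun i => ?_)
    · have h2 : toFiberPoly V (C c) = C (Ideal.Quotient.mk _ (C c)) := by
        rw [← toFiberPoly_inX, inX, rename_C]
      change ψ (toFiberPoly V (C c)) = _
      rw [h2, eval₂Hom_C, hρ, inX, rename_C]
    · rcases i with i | i
      · simp [toFiberPoly, ψ, hρ, inX]
      · simp [toFiberPoly, ψ]
  have h2 : Ideal.span (linForm '' (gradOn V '' vanishingIdeal K V)) ≤ RingHom.ker ψ := by
    rw [Ideal.span_le]
    rintro _ ⟨_, ⟨g, hg, rfl⟩, rfl⟩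
    rw [← toFiberPoly_gradY]
    exact (RingHom.congr_fun h1 (gradY g)).trans (Ideal.Quotient.eq_zero_iff_mem.mpr (hJ' g hg))
  exact Ideal.Quotient.eq_zero_iff_mem.mp ((RingHom.congr_fun h1 F).symm.trans (h2 hF))

theorem eval_inX {K σ : Type*} [Field K] (f : MvPolynomial σ K) (z : σ ⊕ σ → K) :
    eval z (inX f) = eval (z ∘ Sum.inl) f := by
  rw [inX, eval_rename]

theorem eval_gradY {K σ : Type*} [Field K] [Fintype σ] (f : MvPolynomial σ K) (z : σ ⊕ σ → K) :
    eval z (gradY f) = gradDot f (z ∘ Sum.inl) (z ∘ Sum.inr) := by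
  simp [gradY, gradDot, eval_rename]

theorem inX_mem_vanishingIdeal {K σ : Type*} [Field K] [Fintype σ] {V : Set (σ → K)}
    {f : MvPolynomial σ K} (hf : f ∈ vanishingIdeal K V) :
    inX f ∈ vanishingIdeal K (tangentBundle V) := by
  intro z hz
  rw [aeval_eq_eval]
  exact (eval_inX f z).trans (hf _ hz.1)

theorem gradY_mem_vanishingIdeal {K σ : Type*} [Field K] [Fintype σ] {V : Set (σ → K)}
    {f : MvPolynomial σ K} (hf : f ∈ vanishingIdeal K V) :
    gradY f ∈ vanishingIdeal K (tangentBundle V) := by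
  intro z hz
  rw [aeval_eq_eval]
  exact (eval_gradY f z).trans (hz.2 f hf)

theorem isAlgebraicSet_tangentBundle {K σ : Type*} [Field K] [Fintype σ] {V : Set (σ → K)}
    (hV : IsAlgebraicSet V) : IsAlgebraicSet (tangentBundle V) := by
  refine ⟨vanishingIdeal K (tangentBundle V), Set.Subset.antisymm
    (zeroLocus_vanishingIdeal_le _) fun z hz => ⟨?_, fun f hf => ?_⟩⟩
  · rw [← hV.zeroLocus_vanishingIdeal]
    intro f hf
    rw [aeval_eq_eval]
    exact (eval_inX f z).symm.trans (hz _ (inX_mem_vanishingIdeal hf))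
  · exact (eval_gradY f z).symm.trans (hz _ (gradY_mem_vanishingIdeal hf))

theorem vanishingIdeal_tangentBundle_eq {K σ ι : Type*} [Field K] [Infinite K] [Fintype σ]
    [DecidableEq σ] {V : Set (σ → K)} {E : Matrix σ σ (CoordinateRing V)}
    (hE : SplitsAlong V 1 E) (f : ι → MvPolynomial σ K)
    (hf : vanishingIdeal K V = Ideal.span (Set.range f)) :
    vanishingIdeal K (tangentBundle V) =
      Ideal.span (Set.range (fun j => inX (f j)) ∪ Set.range (fun j => gradY (f j))) := by
  have hfV (j : ι) : f j ∈ vanishingIdeal K V := hf ▸ Ideal.subset_span ⟨j, rfl⟩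
  refine le_antisymm (fun F hF => ?_) ?_
  · set J := Ideal.span (Set.range (fun j => inX (f j)) ∪ Set.range (fun j => gradY (f j)))
    have hJ (j : ι) : inX (f j) ∈ J := Ideal.subset_span (Or.inl ⟨j, rfl⟩)
    have hJ' (j : ι) : gradY (f j) ∈ J := Ideal.subset_span (Or.inr ⟨j, rfl⟩)
    refine mem_of_toFiberPoly_mem (V := V) (fun g hg => inX_mem_of_mem_span hJ (hf ▸ hg))
      (fun g hg => gradY_mem_of_mem_span hJ hJ' (hf ▸ hg)) ?_
    exact mem_span_of_linSubst_eq_zero hE (linSubst_toFiberPoly_eq_zero hE.1 hF)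
  · rw [Ideal.span_le]
    rintro _ (⟨j, rfl⟩ | ⟨j, rfl⟩)
    · exact inX_mem_vanishingIdeal (hfV j)
    · exact gradY_mem_vanishingIdeal (hfV j)

/-- `I(TV)` is the kernel of `F ↦ F(x, E y)`, whose target `K[V][y]` is a domain. -/
theorem isPrime_vanishingIdeal_tangentBundle {K σ : Type*} [Field K] [Infinite K] [Fintype σ]
    [DecidableEq σ] {V : Set (σ → K)} [IsDomain (CoordinateRing V)]
    {E : Matrix σ σ (CoordinateRing V)} (hE : SplitsAlong V 1 E) :
    (vanishingIdeal K (tangentBundle V)).IsPrime := by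
  have h : vanishingIdeal K (tangentBundle V) =
      RingHom.ker ((linSubst E : _ →+* MvPolynomial σ (CoordinateRing V)).comp
        (toFiberPoly V : _ →+* MvPolynomial σ (CoordinateRing V))) := by
    refine le_antisymm (fun F hF => linSubst_toFiberPoly_eq_zero hE.1 hF) fun F hF => ?_
    refine mem_of_toFiberPoly_mem (V := V) (fun g hg => inX_mem_vanishingIdeal hg)
      (fun g hg => gradY_mem_vanishingIdeal hg) ?_
    exact mem_span_of_linSubst_eq_zero hE hF
  rw [h]
  exact RingHom.ker_isPrime _

end AffineVariety

/-! ### Dimension and regularity of the tangent bundle. -/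

theorem Ideal.Quotient.algebraicIndependent_mk_comp {K R B ι : Type*} [CommRing K] [CommRing R]
    [CommRing B] [Algebra K R] [Algebra K B] {I : Ideal R} (τ : R →ₐ[K] B)
    (hτ : ∀ a ∈ I, τ a = 0) {x : ι → R} (hx : AlgebraicIndependent K (τ ∘ x)) :
    AlgebraicIndependent K (Ideal.Quotient.mk I ∘ x) :=
  AlgebraicIndependent.of_comp (Ideal.Quotient.liftₐ I τ hτ) hx

theorem MvPolynomial.algebraicIndependent_sumElim_smul_X {K A σ ι κ : Type*} [CommRing K]
    [CommRing A] [IsDomain A] [Algebra K A] {x : κ → A} (hx : AlgebraicIndependent K x)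
    {e : ι → σ} (he : Function.Injective e) {a : A} (ha : a ≠ 0) :
    AlgebraicIndependent K (Sum.elim (fun s => a • X (e s))
      (fun i => algebraMap A (MvPolynomial σ A) (x i))) := by
  refine AlgebraicIndependent.sumElim_of_tower (S := A) ?_ ?_ ?_
  · exact hx.map' (f := IsScalarTower.toAlgHom K A (MvPolynomial σ A)) (C_injective σ _)
  · rintro _ ⟨i, rfl⟩
    exact ⟨_, rfl⟩
  · have h2 : AlgebraicIndependent A fun s => (X (e s) : MvPolynomial σ A) :=
      (algebraicIndependent_X σ A).comp _ he
    have h3 := h2.polynomial_aeval_of_transcendental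
      (f := fun _ => Polynomial.C a * Polynomial.X) fun _ =>
        Polynomial.transcendental _ (by simp [Polynomial.natDegree_C_mul_X a ha])
          (by simpa using ha)
    simpa [smul_eq_C_mul] using h3

namespace AffineVariety

theorem pderiv_inl_inX {K σ : Type*} [Field K] (f : MvPolynomial σ K) (i : σ) :
    pderiv (Sum.inl i) (inX f) = inX (pderiv i f) :=
  pderiv_rename Sum.inl_injective _ _

theorem pderiv_inr_inX {K σ : Type*} [Field K] (f : MvPolynomial σ K) (i : σ) :
    pderiv (Sum.inr i) (inX f) = 0 := by
  classical
  refine pderiv_eq_zero_of_notMem_vars fun h => ?_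
  have h1 := vars_rename Sum.inl f h
  simp at h1

theorem gradDot_inX {K σ : Type*} [Field K] [Fintype σ] (f : MvPolynomial σ K)
    (q w : σ ⊕ σ → K) : gradDot (inX f) q w = gradDot f (q ∘ Sum.inl) (w ∘ Sum.inl) := by
  simp [gradDot, pderiv_inl_inX, pderiv_inr_inX, eval_inX]

/-- Second derivatives of `f` occur only against the `x`-part of `w`, which `hw` makes zero. -/
theorem gradDot_gradY {K σ : Type*} [Field K] [Fintype σ] (f : MvPolynomial σ K)
    {q w : σ ⊕ σ → K} (hw : w ∘ Sum.inl = 0) :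
    gradDot (gradY f) q w = gradDot f (q ∘ Sum.inl) (w ∘ Sum.inr) := by
  classical
  have h0 (i : σ) : w (Sum.inl i) = 0 := congrFun hw i
  have h1 (i : σ) : pderiv (Sum.inr i) (gradY f) = inX (pderiv i f) := by
    change pderiv (Sum.inr i) (∑ j, inX (pderiv j f) * X (Sum.inr j)) = _
    rw [map_sum, Finset.sum_eq_single i]
    · simp [pderiv_inr_inX]
    · intro j _ hj
      rw [pderiv_mul, pderiv_inr_inX, pderiv_X_of_ne (by simpa using hj)]
      simp
    · simp
  simp [gradDot, h0, h1, eval_inX]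

/-- Project a tangent vector `(u, v)` to `u`. The equations `inX f` put `u` in `T_xV`; on the
kernel, the equations `gradY f` put `v` in `T_xV`. -/
theorem finrank_tangentSpace_tangentBundle_le {K σ : Type*} [Field K] [Fintype σ]
    (V : Set (σ → K)) (q : σ ⊕ σ → K) :
    Module.finrank K (tangentSpace (tangentBundle V) q) ≤
      2 * Module.finrank K (tangentSpace V (q ∘ Sum.inl)) := by
  let π : tangentSpace (tangentBundle V) q →ₗ[K] tangentSpace V (q ∘ Sum.inl) :=
    ((LinearMap.funLeft K K Sum.inl).comp (Submodule.subtype _)).codRestrict _ fun w f hf =>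
      (gradDot_inX f q w).symm.trans (w.2 _ (inX_mem_vanishingIdeal hf))
  let ρ : LinearMap.ker π →ₗ[K] tangentSpace V (q ∘ Sum.inl) :=
    ((LinearMap.funLeft K K Sum.inr).comp
      ((Submodule.subtype _).comp (Submodule.subtype _))).codRestrict _ fun w f hf =>
        (gradDot_gradY f (congrArg Subtype.val (LinearMap.mem_ker.mp w.2))).symm.trans
          (w.1.2 _ (gradY_mem_vanishingIdeal hf))
  have hρ : Function.Injective ρ := by
    intro w w' h
    refine Subtype.ext (Subtype.ext (funext ?_))
    rintro (i | i)
    · exact (congrFun (congrArg Subtype.val (LinearMap.mem_ker.mp w.2)) i).trans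
        (congrFun (congrArg Subtype.val (LinearMap.mem_ker.mp w'.2)) i).symm
    · exact congrFun (congrArg Subtype.val h) i
  have h1 := π.finrank_range_add_finrank_ker
  have h2 := LinearMap.finrank_le_finrank_of_injective hρ
  have h3 := (LinearMap.range π).finrank_le
  omega

/-- The substitution kills `I(TV)`, sends `y_s` to `a y_s` for `s ∈ S`, and sends lifts of the `g (X
i)` to constants. The images are independent in `K[V][y]`, hence so are the functions on `TV`. -/
theorem exists_algebraicIndependent_tangentBundle {K σ : Type*} [Field K] [Infinite K] [Fintype σ]
    {V : Set (σ → K)} [IsDomain (CoordinateRing V)] {d : ℕ}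
    (g : MvPolynomial (Fin d) K →ₐ[K] CoordinateRing V) (hg : Function.Injective g)
    {S : Finset σ} {a : CoordinateRing V} (ha : a ≠ 0) {E : Matrix σ σ (CoordinateRing V)}
    (hE : ∀ f ∈ vanishingIdeal K V, Matrix.vecMul (gradOn V f) E = 0)
    (hES : ∀ s ∈ S, linForm (E s) = a • X s) :
    ∃ x : S ⊕ Fin d → CoordinateRing (tangentBundle V), AlgebraicIndependent K x := by
  let τ : MvPolynomial (σ ⊕ σ) K →ₐ[K] MvPolynomial σ (CoordinateRing V) :=
    ((linSubst E).restrictScalars K).comp (toFiberPoly V)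
  choose f hf using fun i : Fin d => Ideal.Quotient.mk_surjective (g (X i))
  have hτ : ∀ F ∈ vanishingIdeal K (tangentBundle V), τ F = 0 :=
    fun F hF => linSubst_toFiberPoly_eq_zero hE hF
  refine ⟨_, Ideal.Quotient.algebraicIndependent_mk_comp
    (B := MvPolynomial σ (CoordinateRing V)) τ hτ
    (x := Sum.elim (fun s : S => X (Sum.inr s.1)) (fun i => inX (f i))) ?_⟩
  have h1 : τ ∘ Sum.elim (fun s : S => X (Sum.inr s.1)) (fun i => inX (f i)) =
      Sum.elim (fun s : S => a • X s.1)
        (fun i => algebraMap (CoordinateRing V) (MvPolynomial σ (CoordinateRing V)) (g (X i))) := by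
    ext1 (s | i)
    · change linSubst E (toFiberPoly V (X (Sum.inr s.1))) = a • X s.1
      rw [← hES s s.2, toFiberPoly, aeval_X, Sum.elim_inr, linSubst, aeval_X]
    · change linSubst E (toFiberPoly V (inX (f i))) = algebraMap _ _ (g (X i))
      rw [toFiberPoly_inX, hf, ← algebraMap_eq, AlgHom.commutes]
  rw [h1]
  exact algebraicIndependent_sumElim_smul_X
    ((algebraicIndependent_X (Fin d) K).map' hg) Subtype.val_injective ha

theorem isRegularLocalRing_of_finrank_tangentSpace_le {K σ : Type*} [Field K] [Fintype σ]
    {W : Set (σ → K)} (p : W) (R : Type*) [CommRing R] [IsLocalRing R] [Algebra (CoordinateRing W) R]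
    [IsLocalization.AtPrime R (idealAt W p)] {d : ℕ} (hd : (idealAt W p).height = d)
    (hle : Module.finrank K (tangentSpace W p) ≤ d) : IsRegularLocalRing R := by
  have hnoeth : IsNoetherianRing R :=
    IsLocalization.isNoetherianRing (idealAt W p).primeCompl _ inferInstance
  refine IsRegularLocalRing.of_spanFinrank_maximalIdeal_le R ?_
  rw [IsLocalization.AtPrime.ringKrullDim_eq_height (idealAt W p), hd]
  exact_mod_cast (spanFinrank_le_finrank_tangentSpace W p R).trans hle

theorem height_idealAt_le_finrank_tangentSpace {K σ : Type*} [Field K] [Fintype σ]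
    (W : Set (σ → K)) (p : W) :
    (idealAt W p).height ≤ Module.finrank K (tangentSpace W p) := by
  have hnoeth : IsNoetherianRing (Localization.AtPrime (idealAt W p)) :=
    IsLocalization.isNoetherianRing (idealAt W p).primeCompl _ inferInstance
  have h1 := ringKrullDim_le_spanFinrank_maximalIdeal (R := Localization.AtPrime (idealAt W p))
  rw [IsLocalization.AtPrime.ringKrullDim_eq_height (idealAt W p)] at h1
  have h2 := spanFinrank_le_finrank_tangentSpace W p (Localization.AtPrime (idealAt W p))
  exact (by exact_mod_cast h1 : (idealAt W p).height ≤ _).trans (by exact_mod_cast h2)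

theorem isDomain_coordinateRing {K σ : Type*} [Field K] {V : Set (σ → K)}
    (hV : (vanishingIdeal K V).IsPrime) : IsDomain (CoordinateRing V) :=
  Ideal.Quotient.isDomain _

end AffineVariety

/-! ### Assembly of the theorem. -/

theorem mainTheorem8 {K : Type*} [Field K] [IsAlgClosed K] [CharZero K] (n d : ℕ)
    (V : Set (Fin n → K)) (hV : AffineVariety.IsAlgebraicSet V)
    (hsmooth : AffineVariety.IsSmooth V) (hirr : AffineVariety.IsIrreducibleSet V)
    (hdim : AffineVariety.dimension V = (d : WithBot ℕ∞)) :
    AffineVariety.IsAlgebraicSet (AffineVariety.tangentBundle V) ∧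
    AffineVariety.IsSmooth (AffineVariety.tangentBundle V) ∧
    AffineVariety.IsIrreducibleSet (AffineVariety.tangentBundle V) ∧
    AffineVariety.dimension (AffineVariety.tangentBundle V) = ((2 * d : ℕ) : WithBot ℕ∞) ∧
    ∀ (r : ℕ) (f : Fin r → MvPolynomial (Fin n) K),
      MvPolynomial.vanishingIdeal K V = Ideal.span (Set.range f) →
      MvPolynomial.vanishingIdeal K (AffineVariety.tangentBundle V) =
        Ideal.span (Set.range (fun j => AffineVariety.inX (f j)) ∪
          Set.range (fun j => AffineVariety.gradY (f j))) := by
  open AffineVariety in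
  have hdom := isDomain_coordinateRing (isIrreducibleSet_iff_isPrime_vanishingIdeal.mp hirr)
  obtain ⟨s, ⟨g, hg⟩, hheight, hkrull, -⟩ :=
    exists_dimension_of_finiteType_isDomain K (CoordinateRing V)
  obtain rfl : s = d := by
    rw [dimension_eq_ringKrullDim hV, hkrull] at hdim
    exact_mod_cast hdim
  have htangent (p : V) : Module.finrank K (tangentSpace V p) = s := by
    have := hsmooth p
    refine finrank_tangentSpace_eq_of_isRegularLocalRing p (LocalRing V p) ?_
    rw [IsLocalization.AtPrime.ringKrullDim_eq_height (idealAt V p),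
      hheight _ (idealAt_isMaximal V p)]
    rfl
  obtain ⟨E, hE⟩ := exists_splitsAlong_one hV htangent
  have hTV := isAlgebraicSet_tangentBundle hV
  have hTprime := isPrime_vanishingIdeal_tangentBundle hE
  have hTdom := isDomain_coordinateRing hTprime
  obtain ⟨t, -, htheight, htkrull, htindep⟩ :=
    exists_dimension_of_finiteType_isDomain K (CoordinateRing (tangentBundle V))
  have htangent' (q : tangentBundle V) :
      Module.finrank K (tangentSpace (tangentBundle V) q) ≤ 2 * s :=
    (finrank_tangentSpace_tangentBundle_le V q).trans_eq
      (congrArg (2 * ·) (htangent ⟨(q : Fin n ⊕ Fin n → K) ∘ Sum.inl, q.2.1⟩))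
  obtain ⟨p, hp⟩ : V.Nonempty := hirr.1
  have ht : t = 2 * s := by
    refine le_antisymm ?_ ?_
    -- All maximal ideals have the same height `t`, so one point suffices; it is taken on the zero
    -- section.
    · have hq : Sum.elim p 0 ∈ tangentBundle V :=
        ⟨hp, (tangentSpace V p).zero_mem⟩
      have h1 := height_idealAt_le_finrank_tangentSpace (tangentBundle V) ⟨_, hq⟩
      rw [htheight _ (idealAt_isMaximal _ _)] at h1
      exact (by exact_mod_cast h1 : t ≤ _).trans (htangent' ⟨_, hq⟩)
    -- The local splitting is used here because, unlike the global `E`, it is known to act as the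
    -- scalar `a` on `d` of the coordinates.
    · obtain ⟨S, a, F, hS, ha, hF, hFS⟩ := exists_splitsAlong htangent ⟨p, hp⟩
      have ha0 : a ≠ 0 := fun h => ha (by rw [h, map_zero])
      obtain ⟨x, hx⟩ := exists_algebraicIndependent_tangentBundle g hg ha0 hF.1
        fun i hi => by rw [hFS i hi, map_smul, linForm_single]
      have h1 := htindep _ x hx
      rw [Fintype.card_sum, Fintype.card_coe, Fintype.card_fin, hS] at h1
      omega
  subst ht
  refine ⟨hTV, fun q => ?_, isIrreducibleSet_iff_isPrime_vanishingIdeal.mpr hTprime, ?_,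
    fun r f hf => vanishingIdeal_tangentBundle_eq hE f hf⟩
  · exact isRegularLocalRing_of_finrank_tangentSpace_le q (LocalRing (tangentBundle V) q)
      (htheight _ (idealAt_isMaximal _ q)) (htangent' q)
  · rw [dimension_eq_ringKrullDim hTV, htkrull]
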